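/- **Conventions.** A compactification of a space $Y$ is a compact Hausdorff space $\overline Y$ containing $Y$ as a dense subspace. A closed set $Z\subseteq K$ is a $\mathcal Z$-set in $K$ if there is a homotopy $\alpha:K\times[0,1]\to K$ with $\alpha_0=\mathrm{id}_K$ and $\alpha_t(K)\subseteq K\setminus Z$ for all $t>0$. A $\mathcal Z$-compactification of $Y$ is a compactification $\overline Y$ such that its boundary $\overline Y\setminus Y$ is a $\mathcal Z$-set in $\overline Y$. A $\mathcal Z$-compactification $\overline Y$ of a proper metric space $(Y,d)$ is controlled if for every $R>0$ and every open cover $\mathcal U$ of $\overline Y$ there is a compact set $C\subset Y$ such that every $A\subseteq Y\setminus C$ with $\operatorname{diam}_d(A)<R$ is contained in some $U\in\mathcal U$. The suspension $SZ$ of a space $Z$ is the quotient of $Z\times[-\infty,\infty]$ in which $Z\times\{\infty\}$ is collapsed to one point and $Z\times\{-\infty\}$ to another, with the usual convention that $S\emptyset$ is the discrete two-point space. $B_d[x,r]$ denotes the closed ball. **Theorem.** Let $\overline X=X\sqcup Z$ be a controlled $\mathcal Z$-compactification of a contractible proper metric space $(X,d)$, and let $\eta:[0,\infty)\to[0,\infty)$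 be an arbitrary monotone increasing function (not necessarily strictly increasing or continuous) with $\lim_{r\to\infty}\eta(r)=\infty$. Then there is a $\mathcal Z$-compactification $\overline{X\times\mathbb R}$ of $X\times\mathbb R$ whose boundary is homeomorphic to $SZ$ and which satisfies the following control condition: (‡) For each open cover $\mathcal U$ of $\overline{X\times\mathbb R}$ there exist a compact set $Q\subseteq X$ and a number $N\ge 0$ such that, for every $k\in\mathbb Z$ and every $x\in X$, if the set $B_d[x,\eta(|k|)]\times[k,k+1]$ is disjoint from $Q\times[-N,N]$, then it is contained in some $U\in\mathcal U$. -/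

import Mathlib

open Set Filter Topology
open scoped NNReal unitInterval

universe u v

/-- A (Hausdorff) compactification of `Y`: a dense topological embedding `i` of `Y` into a compact
Hausdorff space `K`. The remainder is `(range i)ᶜ`. -/
structure IsCompactification {Y K : Type*} [TopologicalSpace Y] [TopologicalSpace K]
    (i : Y → K) : Prop where
  compactSpace : CompactSpace K
  t2Space : T2Space K
  isEmbedding : IsEmbedding i
  denseRange : DenseRange i

/-- A closed set `Z ⊆ K` is a `Z`-set if there is a homotopy `α` of `K` with `α₀ = id` and
`αₜ(K) ∩ Z = ∅` for all `t > 0`. -/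
def IsZSet {K : Type*} [TopologicalSpace K] (Z : Set K) : Prop :=
  IsClosed Z ∧ ∃ α : K × I → K, Continuous α ∧ (∀ y, α (y, 0) = y) ∧
    ∀ (y : K) (t : I), 0 < t → α (y, t) ∉ Z

/-- A `Z`-compactification: a compactification whose remainder is a `Z`-set. -/
structure IsZCompactification {Y K : Type*} [TopologicalSpace Y] [TopologicalSpace K]
    (i : Y → K) : Prop extends IsCompactification i where
  isZSet : IsZSet (range i)ᶜ

/-- A collection of open subsets of `K` whose union is `K`. -/
def IsOpenCovering {K : Type*} [TopologicalSpace K] (𝒰 : Set (Set K)) : Prop :=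
  (∀ U ∈ 𝒰, IsOpen U) ∧ ⋃₀ 𝒰 = univ

/-- A controlled `Z`-compactification of a metric space `Y`: a `Z`-compactification such that, for
every `R > 0` and every open cover, each set of diameter `< R` that misses a suitable compact set
lies in a single member of the cover. (The diameter is the extended one, so that it is infinite for
unbounded sets.) -/
structure IsControlledZCompactification {Y K : Type*} [MetricSpace Y] [TopologicalSpace K]
    (i : Y → K) : Prop extends IsZCompactification i where
  controlled : ∀ R : ℝ, 0 < R → ∀ 𝒰 : Set (Set K), IsOpenCovering 𝒰 →
    ∃ C : Set Y, IsCompact C ∧ ∀ A : Set Y, A ⊆ Cᶜ → Metric.ediam A < ENNReal.ofReal R →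
      ∃ U ∈ 𝒰, i '' A ⊆ U

/-- The gluing of `Z × [-∞, ∞]` to two poles: all points `(z, ∞)` are identified with the pole
`true` and all points `(z, -∞)` with the pole `false`. -/
inductive Suspension.Rel (Z : Type*) : (Z × EReal) ⊕ Bool → (Z × EReal) ⊕ Bool → Prop
  | top (z : Z) : Suspension.Rel Z (Sum.inl (z, ⊤)) (Sum.inr true)
  | bot (z : Z) : Suspension.Rel Z (Sum.inl (z, ⊥)) (Sum.inr false)

/-- The suspension `SZ`, with the quotient topology. For nonempty `Z` this is the quotient of
`Z × [-∞, ∞]` by `(z, ∞) ∼ (z', ∞)` and `(z, -∞) ∼ (z', -∞)`; the two poles are also present when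
`Z` is empty, so that `S∅` is the two-point discrete space. -/
def Suspension (Z : Type*) : Type _ := Quot (Suspension.Rel Z)

instance Suspension.instTopologicalSpace (Z : Type*) [TopologicalSpace Z] :
    TopologicalSpace (Suspension Z) :=
  inferInstanceAs (TopologicalSpace (Quot (Suspension.Rel Z)))

/-- The control condition for a compactification `j : X × ℝ → W`: for each open cover of `W` there
is a compact set `Q × [-N, N]` such that, for every integer `k` and every `x`, the set
`B[x, η(|k|)] × [k, k + 1]` lies in a single member of the cover as soon as it is disjoint from
`Q × [-N, N]`. -/
def SatisfiesControlCondition {X W : Type*} [MetricSpace X] [TopologicalSpace W]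
    (η : ℝ≥0 → ℝ≥0) (j : X × ℝ → W) : Prop :=
  ∀ 𝒰 : Set (Set W), IsOpenCovering 𝒰 →
    ∃ (Q : Set X) (N : ℝ), IsCompact Q ∧ 0 ≤ N ∧ ∀ (k : ℤ) (x : X),
      Disjoint (Metric.closedBall x (η (Real.nnabs (k : ℝ))) ×ˢ Icc (k : ℝ) (k + 1))
        (Q ×ˢ Icc (-N) N) →
      ∃ U ∈ 𝒰, j '' (Metric.closedBall x (η (Real.nnabs (k : ℝ))) ×ˢ Icc (k : ℝ) (k + 1)) ⊆ U

/-! The compactification is the suspension of `Xbar` itself, with `X × ℝ` placed in it by slopes: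
`(x, r)` goes to the class of `(i x, r / p x)`, where `p x = g (dist x x₀)`. Any positive continuous
`p` gives a Z-compactification with boundary `SZ`: the points missed are the poles and the points of
finite height over `Z`, and a contraction of `Xbar` through `X`, combined with truncation of
heights, moves the suspension off them (`Suspension.exists_homotopy`).

The choice of `g` provides the control. Since `Xbar` is metrizable and controlled, there are radii
`φ r` beyond which balls of radius `η r` have size `O(1/r)` in `Xbar`. By `exists_slow_subadditive`
there is a subadditive `g`, tending to infinity, with `g (φ r) = o(r)`. Let boxes `B[x, η |k|] × [k,
k + 1]` escape to infinity (`Suspension.tendsto_slopeMap`). If `k / p x` stays bounded, then `p x →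
∞` and `|k| = O(p x)`, so slowness of `g` puts `x` beyond the relevant radius: the box is thin in
the `Xbar` direction, and subadditivity makes `p` asymptotically constant on it, so all slopes agree
in the limit. If `|k| / p x → ∞`, then `p` exceeds `p x` by at most `o(|k|)` on the ball, and the
whole box tends to a pole. Compactness turns this into the control condition. -/

namespace Suspension

/-! ### Points and topology of the suspension -/

variable {Y : Type*}

/-- The class of `(y, s)` in the suspension of `Y`. -/
def mk (y : Y) (s : EReal) : Suspension Y := Quot.mk _ (Sum.inl (y, s))

/-- The two poles of the suspension: `true` at `∞`, `false` at `-∞`. -/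
def pole (Y : Type*) (b : Bool) : Suspension Y := Quot.mk _ (Sum.inr b)

theorem mk_top (y : Y) : mk y ⊤ = pole Y true := Quot.sound (.top y)

theorem mk_bot (y : Y) : mk y ⊥ = pole Y false := Quot.sound (.bot y)

theorem ind {P : Suspension Y → Prop} (h₁ : ∀ y s, P (mk y s)) (h₂ : ∀ b, P (pole Y b))
    (w : Suspension Y) : P w := by
  obtain ⟨⟨y, s⟩ | b, rfl⟩ := Quot.exists_rep w
  exacts [h₁ y s, h₂ b]

/-- The height `s` of the class of `(y, s)`. -/
noncomputable def height : Suspension Y → EReal :=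
  Quot.lift (Sum.elim Prod.snd fun b => if b then ⊤ else ⊥) (by
    rintro _ _ (z | z) <;> simp)

@[simp] theorem height_mk (y : Y) (s : EReal) : height (mk y s) = s := rfl

@[simp] theorem height_pole_true : height (pole Y true) = ⊤ := rfl

@[simp] theorem height_pole_false : height (pole Y false) = ⊥ := rfl

open Classical in
/-- The base point `y` of the class of `(y, s)`, for finite `s`. -/
noncomputable def base : Suspension Y → Option Y :=
  Quot.lift (Sum.elim (fun a => if a.2 = ⊤ ∨ a.2 = ⊥ then none else some a.1) fun _ => none) (by
    rintro _ _ (z | z) <;> simp)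

theorem base_mk (y : Y) {s : EReal} (h₁ : s ≠ ⊤) (h₂ : s ≠ ⊥) : base (mk y s) = some y := by
  change (if s = ⊤ ∨ s = ⊥ then none else some y) = some y
  simp [h₁, h₂]

theorem eq_pole_true {w : Suspension Y} (h : height w = ⊤) : w = pole Y true := by
  induction w using ind with
  | h₁ y s => rw [height_mk] at h; rw [h, mk_top]
  | h₂ b => cases b <;> simp_all

theorem eq_pole_false {w : Suspension Y} (h : height w = ⊥) : w = pole Y false := by
  induction w using ind with
  | h₁ y s => rw [height_mk] at h; rw [h, mk_bot]
  | h₂ b => cases b <;> simp_all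

theorem exists_mk {w : Suspension Y} (h₁ : height w ≠ ⊤) (h₂ : height w ≠ ⊥) :
    ∃ y, w = mk y (height w) := by
  induction w using ind with
  | h₁ y s => exact ⟨y, rfl⟩
  | h₂ b => cases b <;> simp_all

theorem mk_surjective [Nonempty Y] : Function.Surjective fun a : Y × EReal => mk a.1 a.2 := by
  obtain ⟨y⟩ := ‹Nonempty Y›
  intro w
  induction w using ind with
  | h₁ y s => exact ⟨(y, s), rfl⟩
  | h₂ b =>
    cases b
    exacts [⟨(y, ⊥), mk_bot y⟩, ⟨(y, ⊤), mk_top y⟩]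

/-- The map of suspensions induced by a map of spaces. -/
def map {Y' : Type*} (f : Y → Y') : Suspension Y → Suspension Y' :=
  Quot.map (Sum.map (Prod.map f id) id) (by
    rintro _ _ (z | z)
    exacts [.top _, .bot _])

theorem height_map {Y' : Type*} (f : Y → Y') (w : Suspension Y) : height (map f w) = height w := by
  induction w using ind <;> rfl

/-- A point is determined by its height and, when the height is finite, its base. -/
theorem map_injective {Y' : Type*} {f : Y → Y'} (hf : Function.Injective f) :
    Function.Injective (map f) := by
  intro w w' h
  have hh : height w = height w' := by rw [← height_map f, h, height_map]
  by_cases ht : height w = ⊤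
  · rw [eq_pole_true ht, eq_pole_true (hh.symm.trans ht)]
  by_cases hb : height w = ⊥
  · rw [eq_pole_false hb, eq_pole_false (hh.symm.trans hb)]
  obtain ⟨y, hy⟩ := exists_mk ht hb
  obtain ⟨y', hy'⟩ := exists_mk (hh ▸ ht) (hh ▸ hb)
  rw [← hh] at hy'
  rw [hy, hy'] at h
  have := congrArg base h
  change base (mk (f y) (height w)) = base (mk (f y') (height w)) at this
  rw [base_mk _ ht hb, base_mk _ ht hb] at this
  rw [hy, hy', hf (Option.some_injective _ this)]

variable [TopologicalSpace Y]

theorem continuous_mk : Continuous fun a : Y × EReal => mk a.1 a.2 :=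
  continuous_quot_mk.comp continuous_inl

theorem continuous_height : Continuous (height : Suspension Y → EReal) :=
  continuous_quot_lift _ (continuous_snd.sumElim continuous_of_discreteTopology)

instance [CompactSpace Y] : CompactSpace (Suspension Y) :=
  inferInstanceAs (CompactSpace (Quot (Suspension.Rel Y)))

/-- The part of the suspension over an open set, without the poles, is open. -/
theorem isOpen_image_mk {V : Set (Y × EReal)} (hV : IsOpen V) (h : ∀ a ∈ V, a.2 ≠ ⊤ ∧ a.2 ≠ ⊥) :
    IsOpen ((fun a : Y × EReal => mk a.1 a.2) '' V) := by
  change IsOpen ((Quot.mk (Suspension.Rel Y)) ⁻¹' _)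
  -- Nothing is glued at finite heights, so `V` is saturated.
  have key : (Quot.mk (Suspension.Rel Y)) ⁻¹' ((fun a : Y × EReal => mk a.1 a.2) '' V) =
      Sum.inl '' V := by
    ext w
    constructor
    · rintro ⟨⟨y, s⟩, ha, he⟩
      obtain ⟨h₁, h₂⟩ := h _ ha
      have hh := congrArg height he
      have hb := congrArg base he
      rw [base_mk y h₁ h₂] at hb
      rcases w with ⟨y', s'⟩ | b
      · change s = s' at hh
        subst hh
        change _ = base (mk y' s) at hb
        rw [base_mk y' h₁ h₂] at hb
        cases hb
        exact ⟨_, ha, rfl⟩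
      · exact absurd hb (by simp [base])
    · rintro ⟨⟨y, s⟩, ha, rfl⟩
      exact ⟨_, ha, rfl⟩
  exact (congrArg IsOpen key).mpr (isOpenMap_inl _ hV)

/-- Distinct heights are separated by `height`. At a common finite height, disjoint neighbourhoods
of the base points, times all finite heights, have open images. -/
instance [T2Space Y] : T2Space (Suspension Y) := by
  refine ⟨fun w w' hne => ?_⟩
  by_cases hh : height w = height w'
  · have ht : height w ≠ ⊤ := fun h => hne (by rw [eq_pole_true h, eq_pole_true (hh.symm.trans h)])
    have hb : height w ≠ ⊥ := fun h => hne (by rw [eq_pole_false h, eq_pole_false (hh.symm.trans h)])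
    obtain ⟨y, hy⟩ := exists_mk ht hb
    obtain ⟨y', hy'⟩ := exists_mk (hh ▸ ht) (hh ▸ hb)
    rw [← hh] at hy'
    have hyy : y ≠ y' := by
      rintro rfl
      exact hne (hy.trans hy'.symm)
    obtain ⟨U, V, hU, hV, hyU, hyV, hd⟩ := t2_separation hyy
    have hI : IsOpen (Ioo (⊥ : EReal) ⊤) := isOpen_Ioo
    have hs : height w ∈ Ioo (⊥ : EReal) ⊤ := ⟨bot_lt_iff_ne_bot.2 hb, lt_top_iff_ne_top.2 ht⟩
    refine ⟨_, _, isOpen_image_mk (hU.prod hI) fun a ha => ⟨ha.2.2.ne, ha.2.1.ne'⟩,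
      isOpen_image_mk (hV.prod hI) fun a ha => ⟨ha.2.2.ne, ha.2.1.ne'⟩,
      ⟨(y, _), ⟨hyU, hs⟩, hy.symm⟩, ⟨(y', _), ⟨hyV, hs⟩, hy'.symm⟩, ?_⟩
    rw [disjoint_left]
    rintro _ ⟨⟨a, s⟩, ha, rfl⟩ ⟨⟨b, t⟩, hb, he⟩
    have := congrArg base he
    rw [base_mk _ hb.2.2.ne hb.2.1.ne', base_mk _ ha.2.2.ne ha.2.1.ne'] at this
    cases this
    exact disjoint_left.1 hd ha.1 hb.1
  · exact separated_by_continuous continuous_height hh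

/-- Points whose height tends to `∞` tend to the upper pole. -/
theorem tendsto_mk_top [CompactSpace Y] {ι : Type*} {l : Filter ι} {f : ι → Y} {s : ι → EReal}
    (hs : Tendsto s l (𝓝 ⊤)) : Tendsto (fun a => mk (f a) (s a)) l (𝓝 (pole Y true)) := by
  -- Along an ultrafilter the base points converge by compactness, although `f` itself need not.
  rw [tendsto_iff_ultrafilter]
  intro 𝒢 h𝒢
  obtain ⟨y, hy⟩ : ∃ y, Tendsto f 𝒢 (𝓝 y) := ⟨_, (𝒢.map f).le_nhds_lim⟩
  rw [← mk_top y]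
  exact (continuous_mk.tendsto (y, ⊤)).comp (hy.prodMk_nhds (hs.mono_left h𝒢))

/-- Points whose height tends to `-∞` tend to the lower pole. -/
theorem tendsto_mk_bot [CompactSpace Y] {ι : Type*} {l : Filter ι} {f : ι → Y} {s : ι → EReal}
    (hs : Tendsto s l (𝓝 ⊥)) : Tendsto (fun a => mk (f a) (s a)) l (𝓝 (pole Y false)) := by
  rw [tendsto_iff_ultrafilter]
  intro 𝒢 h𝒢
  obtain ⟨y, hy⟩ : ∃ y, Tendsto f 𝒢 (𝓝 y) := ⟨_, (𝒢.map f).le_nhds_lim⟩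
  rw [← mk_bot y]
  exact (continuous_mk.tendsto (y, ⊥)).comp (hy.prodMk_nhds (hs.mono_left h𝒢))

theorem continuous_map {Y' : Type*} [TopologicalSpace Y'] {f : Y → Y'} (hf : Continuous f) :
    Continuous (map f) :=
  continuous_quot_lift _ (continuous_quot_mk.comp ((hf.prodMap continuous_id).sumMap continuous_id))

end Suspension

/-! ### Consequences of the Z-set property -/

/-- If the complement of an embedded contractible space is a `Z`-set, then the ambient space
contracts to a point of that space, inside that space at all positive times. -/
theorem IsZSet.exists_contraction {X K : Type*} [TopologicalSpace X] [ContractibleSpace X]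
    [TopologicalSpace K] {i : X → K} (hi : IsEmbedding i) (hz : IsZSet (range i)ᶜ) :
    ∃ (x₀ : X) (h : C(I × K, K)), (∀ y, h (0, y) = y) ∧ (∀ y, h (1, y) = i x₀) ∧
      ∀ t y, 0 < t → h (t, y) ∈ range i := by
  obtain ⟨-, α, hα, hα₀, hα₁⟩ := hz
  have hα₂ : ∀ y t, 0 < t → α (y, t) ∈ range i := fun y t ht => not_not.1 (hα₁ y t ht)
  obtain ⟨x₀, ⟨c⟩⟩ := id_nullhomotopic X
  let g : C(K, K) := ⟨fun y => α (y, 1), by fun_prop⟩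
  let F : ContinuousMap.Homotopy (ContinuousMap.id K) g :=
    { toFun := fun a => α (a.2, a.1)
      continuous_toFun := by fun_prop
      map_zero_left := hα₀
      map_one_left := fun _ => rfl }
  -- The final map of the Z-set homotopy factors through `X`, so the contraction of `X` can be
  -- applied after it.
  let r : C(K, X) := ⟨fun y => hi.toHomeomorph.symm ⟨α (y, 1), hα₂ y 1 one_pos⟩,
    hi.toHomeomorph.symm.continuous.comp (Continuous.subtype_mk (by fun_prop) _)⟩
  have hr : ∀ y, i (r y) = α (y, 1) := fun y =>
    congrArg Subtype.val (hi.toHomeomorph.apply_symm_apply ⟨α (y, 1), hα₂ y 1 one_pos⟩)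
  let G : ContinuousMap.Homotopy g (ContinuousMap.const K (i x₀)) :=
    { toFun := fun a => i (c (a.1, r a.2))
      continuous_toFun := hi.continuous.comp (by fun_prop)
      map_zero_left := fun y => by simp [hr, g]
      map_one_left := fun y => by simp }
  refine ⟨x₀, (F.trans G).toContinuousMap, fun y => (F.trans G).apply_zero y,
    fun y => (F.trans G).apply_one y, fun t y ht => ?_⟩
  change (F.trans G) (t, y) ∈ _
  rw [ContinuousMap.Homotopy.trans_apply]
  split_ifs with h
  · refine hα₂ _ _ ?_
    have : (0 : ℝ) < t := ht
    exact Subtype.coe_lt_coe.1 (by simpa using this)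
  · exact ⟨_, rfl⟩

/-- A compact Hausdorff space is metrizable if the complement of some metrizable subspace is a
`Z`-set. -/
theorem IsZSet.metrizableSpace {X K : Type*} [TopologicalSpace X] [TopologicalSpace.MetrizableSpace X]
    [TopologicalSpace K] [CompactSpace K] [T2Space K] {i : X → K} (hi : IsEmbedding i)
    (hz : IsZSet (range i)ᶜ) : TopologicalSpace.MetrizableSpace K := by
  obtain ⟨-, α, hα, hα₀, hα₁⟩ := hz
  have hα₂ : ∀ y t, 0 < t → α (y, t) ∈ range i := fun y t ht => not_not.1 (hα₁ y t ht)
  let τ : ℕ → I := fun n => ⟨1 / ((n : ℝ) + 1), by positivity,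
    (div_le_one (by positivity)).2 (by linarith [n.cast_nonneg (α := ℝ)])⟩
  have hτ : ∀ n, 0 < τ n := fun n => Subtype.coe_lt_coe.1 (by simp only [τ]; positivity)
  have hτ₀ : Tendsto τ atTop (𝓝 0) :=
    tendsto_subtype_rng.2 tendsto_one_div_add_atTop_nhds_zero_nat
  have : TopologicalSpace.MetrizableSpace (range i) :=
    hi.toHomeomorph.symm.isEmbedding.metrizableSpace
  let _ : MetricSpace (range i) := TopologicalSpace.metrizableSpaceMetric _
  have : TopologicalSpace.MetrizableSpace (ℕ → range i) := UniformSpace.metrizableSpace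
  -- Sampling the homotopy at times `1 / (n + 1)` maps `K` to a countable power of a metrizable
  -- space; the samples converge back to `y`, hence injectivity.
  let f : K → ℕ → range i := fun y n => ⟨α (y, τ n), hα₂ y _ (hτ n)⟩
  have hf : Continuous f :=
    continuous_pi fun n => Continuous.subtype_mk (by fun_prop) _
  have hinj : Function.Injective f := by
    intro y y' h
    have hlim : ∀ y, Tendsto (fun n => α (y, τ n)) atTop (𝓝 y) := fun y => by
      have := (hα.tendsto (y, 0)).comp ((tendsto_const_nhds (x := y)).prodMk_nhds hτ₀)
      rwa [hα₀] at this
    refine tendsto_nhds_unique (hlim y) ((hlim y').congr fun n => ?_)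
    exact congrArg Subtype.val (congrFun h n).symm
  exact (hf.isClosedEmbedding hinj).isEmbedding.metrizableSpace

/-! ### Weight and truncation on the extended line -/

namespace EReal

/-- There is a continuous weight on `[-∞, ∞]` with values in `[0, 1]` that vanishes exactly at the
end points. -/
theorem exists_weight : ∃ v : EReal → ℝ, Continuous v ∧ (∀ s, 0 ≤ v s ∧ v s ≤ 1) ∧
    ∀ s, v s = 0 ↔ s = ⊤ ∨ s = ⊥ := by
  have h1 : ∀ s : EReal, 1 ≤ 1 + (max s (-s)).toENNReal := fun s => le_self_add
  have h2 : ∀ s : EReal, (1 + (max s (-s)).toENNReal)⁻¹ ≤ 1 := fun s => ENNReal.inv_le_one.2 (h1 s)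
  -- The weight is `1 / (1 + |s|)`, with the inverse taken in `[0, ∞]` so that it vanishes at
  -- infinite `s`.
  refine ⟨fun s => ((1 + (max s (-s)).toENNReal)⁻¹).toReal, ?_, fun s => ⟨ENNReal.toReal_nonneg, ?_⟩,
    fun s => ?_⟩
  · refine ENNReal.continuousOn_toReal.comp_continuous ?_ fun s => ne_top_of_le_ne_top (by simp) (h2 s)
    refine continuous_inv.comp (continuous_const.add (EReal.continuous_toENNReal.comp ?_))
    exact continuous_id.max continuous_neg
  · exact ENNReal.toReal_le_of_le_ofReal zero_le_one (by simp [h2 s])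
  · rw [ENNReal.toReal_eq_zero_iff, or_iff_left (ne_top_of_le_ne_top (by simp) (h2 s)),
      ENNReal.inv_eq_zero, ENNReal.add_eq_top, or_iff_right (by simp), EReal.toENNReal_eq_top_iff]
    induction s <;> simp [← EReal.coe_neg, max_eq_top]

/-- The truncation level `1 / t`. -/
noncomputable def level (t : I) : EReal := ((ENNReal.ofReal t)⁻¹ : ENNReal)

theorem continuous_level : Continuous level :=
  continuous_coe_ennreal_ereal.comp (continuous_inv.comp
    (ENNReal.continuous_ofReal.comp continuous_subtype_val))

theorem level_zero : level 0 = ⊤ := by simp [level]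

theorem level_nonneg (t : I) : 0 ≤ level t := EReal.coe_ennreal_nonneg _

theorem level_lt_top {t : I} (ht : 0 < t) : level t < ⊤ := by
  have h : (0 : ℝ) < t := ht
  refine lt_top_iff_ne_top.2 ?_
  simp [level, h]

/-- The truncation of `s` to `[-1/t, 1/t]`. -/
noncomputable def clamp (s : EReal) (t : I) : EReal := max (-level t) (min s (level t))

theorem _root_.Continuous.clamp {T : Type*} [TopologicalSpace T] {f : T → EReal} {g : T → I}
    (hf : Continuous f) (hg : Continuous g) : Continuous fun a => clamp (f a) (g a) :=
  (continuous_neg.comp (continuous_level.comp hg)).max (hf.min (continuous_level.comp hg))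

theorem clamp_zero (s : EReal) : clamp s 0 = s := by simp [clamp, level_zero]

theorem neg_level_le (t : I) : -level t ≤ level t :=
  (EReal.neg_le_neg_iff.2 (level_nonneg t)).trans (by simp [level_nonneg t])

theorem clamp_ne_top (s : EReal) {t : I} (ht : 0 < t) : clamp s t ≠ ⊤ :=
  (max_lt ((neg_level_le t).trans_lt (level_lt_top ht))
    ((min_le_right _ _).trans_lt (level_lt_top ht))).ne

theorem clamp_ne_bot (s : EReal) {t : I} (ht : 0 < t) : clamp s t ≠ ⊥ := by
  refine (lt_of_lt_of_le ?_ (le_max_left _ _)).ne'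
  rw [bot_lt_iff_ne_bot, Ne, EReal.neg_eq_bot_iff]
  exact (level_lt_top ht).ne

end EReal

/-! ### Pushing the suspension off its boundary -/

namespace Suspension

/-- The homotopy of `exists_homotopy` before passing to the quotient. -/
theorem exists_prehomotopy {K : Type*} [TopologicalSpace K] [CompactSpace K] {S : Set K} (k₀ : K)
    (h : C(I × K, K)) (h₀ : ∀ y, h (0, y) = y) (h₁ : ∀ y, h (1, y) = k₀)
    (hS : ∀ t y, 0 < t → h (t, y) ∈ S) :
    ∃ F : C((K × EReal) × I, Suspension K), (∀ y s, F ((y, s), 0) = mk y s) ∧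
      (∀ y s t, 0 < t → ∃ y' ∈ S, ∃ s' : EReal, s' ≠ ⊤ ∧ s' ≠ ⊥ ∧ F ((y, s), t) = mk y' s') ∧
      ∀ y s t, s = ⊤ ∨ s = ⊥ → F ((y, s), t) = F ((k₀, s), t) := by
  obtain ⟨v, hv, hv₁, hv₀⟩ := EReal.exists_weight
  -- Contraction time: it is `t` where `v s = 1`, and for `t > 0` it is `1` where `v s = 0`. Thus
  -- the slices at infinite height are already collapsed to `k₀`, and the homotopy descends to the
  -- suspension.
  let u : EReal → I → ℝ := fun s t => t / (v s + t * (1 - v s))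
  have hden : ∀ s (t : I), (0 < t ∨ v s ≠ 0) → 0 < v s + t * (1 - v s) := by
    intro s t hst
    obtain ⟨h1, h2⟩ := hv₁ s
    have ht0 : (0 : ℝ) ≤ t := t.2.1
    rcases h1.eq_or_lt with h3 | h3
    · have : (0 : ℝ) < t := hst.resolve_right (not_not.2 h3.symm)
      rw [← h3]
      simpa using this
    · have := mul_nonneg ht0 (sub_nonneg.2 h2)
      linarith
  let F : (K × EReal) × I → Suspension K := fun a =>
    mk (h (projIcc 0 1 zero_le_one (u a.1.2 a.2), a.1.1)) (EReal.clamp a.1.2 a.2)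
  have hcl : Continuous fun a : (K × EReal) × I => EReal.clamp a.1.2 a.2 :=
    Continuous.clamp (by fun_prop) (by fun_prop)
  have hF : Continuous F := by
    rw [continuous_iff_continuousAt]
    rintro ⟨⟨y, s⟩, t⟩
    by_cases hst : 0 < t ∨ v s ≠ 0
    · have hu : ContinuousAt (fun a : (K × EReal) × I => u a.1.2 a.2) ((y, s), t) := by
        refine ContinuousAt.div ?_ ?_ (hden s t hst).ne' <;>
        exact Continuous.continuousAt (by fun_prop)
      have hp : ContinuousAt (fun a : (K × EReal) × I => projIcc (0 : ℝ) 1 zero_le_one (u a.1.2 a.2))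
          ((y, s), t) := continuous_projIcc.continuousAt.comp hu
      have hh : ContinuousAt (fun a : (K × EReal) × I =>
          h (projIcc (0 : ℝ) 1 zero_le_one (u a.1.2 a.2), a.1.1)) ((y, s), t) :=
        (h.continuous.tendsto _).comp (hp.prodMk (by fun_prop : Continuous fun a :
          (K × EReal) × I => a.1.1).continuousAt)
      exact (continuous_mk.tendsto _).comp (hh.prodMk hcl.continuousAt)
    -- Here `u` is `0 / 0` and may jump, but the heights tend to infinity, so by compactness of `K`
    -- the base points do not matter.
    · push Not at hst
      obtain ⟨ht, hs⟩ := hst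
      obtain rfl : t = 0 := le_antisymm ht t.2.1
      have hlim := hcl.tendsto ((y, s), (0 : I))
      rw [ContinuousAt]
      simp only [EReal.clamp_zero] at hlim
      rcases (hv₀ s).1 hs with rfl | rfl
      · simp only [F, EReal.clamp_zero, mk_top]
        exact tendsto_mk_top hlim
      · simp only [F, EReal.clamp_zero, mk_bot]
        exact tendsto_mk_bot hlim
  have hF₀ : ∀ y s, F ((y, s), 0) = mk y s := by
    intro y s
    have : u s 0 = 0 := by simp [u]
    simp [F, this, EReal.clamp_zero, h₀]
  have hF₁ : ∀ y s t, 0 < t → ∃ y' ∈ S, ∃ s' : EReal, s' ≠ ⊤ ∧ s' ≠ ⊥ ∧ F ((y, s), t) = mk y' s' := by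
    intro y s t ht
    refine ⟨_, hS _ _ ?_, _, EReal.clamp_ne_top s ht, EReal.clamp_ne_bot s ht, rfl⟩
    have : 0 < u s t := div_pos ht (hden s t (.inl ht))
    refine lt_of_le_of_ne (Subtype.coe_le_coe.1 (projIcc 0 1 _ _).2.1) fun he => ?_
    have := projIcc_eq_left (zero_lt_one' ℝ) |>.1 he.symm
    linarith
  have hF_end : ∀ y s t, v s = 0 → F ((y, s), t) = mk k₀ (EReal.clamp s t) := by
    intro y s t hs
    rcases (t.2.1 : (0 : ℝ) ≤ t).eq_or_lt with ht | ht
    · obtain rfl : t = 0 := Subtype.ext ht.symm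
      rw [hF₀, EReal.clamp_zero]
      rcases (hv₀ s).1 hs with rfl | rfl
      · rw [mk_top, mk_top]
      · rw [mk_bot, mk_bot]
    · have : u s t = 1 := by simp [u, hs, ht.ne']
      simp [F, this, h₁]
  exact ⟨⟨F, hF⟩, hF₀, hF₁, fun y s t hs => (hF_end y s t ((hv₀ s).2 hs)).trans
    (hF_end k₀ s t ((hv₀ s).2 hs)).symm⟩

/-- A contraction of `K` that is inside `S` at positive times induces a homotopy of the suspension
which at positive times is inside `S × ℝ`. -/
theorem exists_homotopy {K : Type*} [TopologicalSpace K] [CompactSpace K] {S : Set K} (k₀ : K)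
    (h : C(I × K, K)) (h₀ : ∀ y, h (0, y) = y) (h₁ : ∀ y, h (1, y) = k₀)
    (hS : ∀ t y, 0 < t → h (t, y) ∈ S) :
    ∃ A : Suspension K × I → Suspension K, Continuous A ∧ (∀ w, A (w, 0) = w) ∧
      ∀ w t, 0 < t → ∃ y ∈ S, ∃ s : EReal, s ≠ ⊤ ∧ s ≠ ⊥ ∧ A (w, t) = mk y s := by
  obtain ⟨F, hF₀, hF₁, hF_end⟩ := exists_prehomotopy k₀ h h₀ h₁ hS
  -- With values in the path space, continuity descends to the quotient without asking whether its
  -- product with `I` is a quotient map.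
  let f : C((K × EReal) ⊕ Bool, C(I, Suspension K)) :=
    ⟨Sum.elim (ContinuousMap.curry F)
      fun b => ContinuousMap.curry F (k₀, if b then ⊤ else ⊥),
      (ContinuousMap.continuous _).sumElim continuous_of_discreteTopology⟩
  have hf : ∀ a b, Rel K a b → f a = f b := by
    rintro _ _ (z | z)
    · ext1 t
      change F ((z, ⊤), t) = F ((k₀, ⊤), t)
      exact hF_end _ _ _ (.inl rfl)
    · ext1 t
      change F ((z, ⊥), t) = F ((k₀, ⊥), t)
      exact hF_end _ _ _ (.inr rfl)
  let g : C(Suspension K, C(I, Suspension K)) :=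
    ⟨Quot.lift f hf, continuous_quot_lift hf f.continuous⟩
  refine ⟨fun a => g a.1 a.2, ContinuousMap.continuous_uncurry_of_continuous g, fun w => ?_,
    fun w t ht => ?_⟩
  · induction w using ind with
    | h₁ y s => exact hF₀ y s
    | h₂ b =>
      cases b
      exacts [(hF₀ k₀ ⊥).trans (mk_bot k₀), (hF₀ k₀ ⊤).trans (mk_top k₀)]
  · induction w using ind with
    | h₁ y s => exact hF₁ y s t ht
    | h₂ b => exact hF₁ k₀ _ t ht

end Suspension

/-! ### Slow functions and escape radii -/

/-- There are subadditive functions tending to infinity arbitrarily slowly. -/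
theorem exists_slow_subadditive (φ : ℕ → ℝ) : ∃ g : ℝ → ℝ, Continuous g ∧ (∀ t, 1 ≤ g t) ∧
    (∀ s t, |s| ≤ |t| → g s ≤ g t) ∧ (∀ s t, g (s + t) ≤ g s + g t) ∧ Tendsto g atTop atTop ∧
    ∀ ε > 0, ∀ᶠ r : ℕ in atTop, g (φ r) ≤ ε * r := by
  -- Because `a n` dominates `φ r` for all `r ≤ n ^ 2`, the index `√r + 1` in the infimum `g` below
  -- gives `g (φ r) = O(√r)`.
  let a : ℕ → ℝ := fun n => 1 + ∑ r ∈ Finset.range (n ^ 2 + 1), |φ r|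
  have ha_mono : Monotone a := fun m n hmn => by
    have : Finset.range (m ^ 2 + 1) ⊆ Finset.range (n ^ 2 + 1) :=
      Finset.range_subset_range.2 (by gcongr)
    exact (add_le_add_iff_left 1).2 (Finset.sum_le_sum_of_subset_of_nonneg this fun _ _ _ => abs_nonneg _)
  have ha1 : ∀ n, 1 ≤ a n := fun n => le_add_of_nonneg_right (Finset.sum_nonneg fun _ _ => abs_nonneg _)
  have ha0 : ∀ n, 0 < a n := fun n => one_pos.trans_le (ha1 n)
  have haφ : ∀ n r, r ≤ n ^ 2 → |φ r| ≤ a n := fun n r hr => by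
    have := Finset.single_le_sum (f := fun r => |φ r|) (fun _ _ => abs_nonneg _)
      (Finset.mem_range.2 (Nat.lt_succ_of_le hr))
    simp only [a]
    linarith
  let f : ℝ → ℕ → ℝ := fun t n => n + 1 + |t| / a n
  have hf1 : ∀ t n, 1 ≤ f t n := fun t n => by
    have : 0 ≤ |t| / a n := div_nonneg (abs_nonneg _) (ha0 n).le
    have : (0 : ℝ) ≤ n := n.cast_nonneg
    simp only [f]
    linarith
  have hbdd : ∀ t, BddBelow (range (f t)) := fun t => ⟨1, by rintro _ ⟨n, rfl⟩; exact hf1 t n⟩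
  let g : ℝ → ℝ := fun t => ⨅ n, f t n
  have hgf : ∀ t n, g t ≤ f t n := fun t n => ciInf_le (hbdd t) n
  have hmono : ∀ s t, |s| ≤ |t| → g s ≤ g t := fun s t hst => le_ciInf fun n =>
    (hgf s n).trans (by
      have := ha0 n
      simp only [f]
      gcongr)
  have hlip : LipschitzWith 1 g := LipschitzWith.of_le_add fun s t => by
    rw [← sub_le_iff_le_add]
    refine le_ciInf fun n => ?_
    rw [sub_le_iff_le_add]
    refine (hgf s n).trans ?_
    have h1 : |s| ≤ |t| + dist s t := by
      have := abs_sub_abs_le_abs_sub s t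
      rw [Real.dist_eq]
      linarith
    have h2 : |s| / a n ≤ |t| / a n + dist s t := by
      calc |s| / a n ≤ (|t| + dist s t) / a n := by have := ha0 n; gcongr
        _ = |t| / a n + dist s t / a n := add_div _ _ _
        _ ≤ _ := by gcongr; exact div_le_self dist_nonneg (ha1 n)
    simp only [f]
    linarith
  -- As `a` is monotone, the larger of two indices serves for the sum; this is the source of
  -- subadditivity.
  have hsub' : ∀ s t m n, m ≤ n → |s + t| / a n ≤ |s| / a m + |t| / a n := fun s t m n hmn => by
    have := ha0 m
    have := ha0 n
    calc |s + t| / a n ≤ (|s| + |t|) / a n := by gcongr; exact abs_add_le s t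
      _ = |s| / a n + |t| / a n := add_div _ _ _
      _ ≤ _ := by gcongr; exact ha_mono hmn
  refine ⟨g, hlip.continuous, fun t => le_ciInf (hf1 t), hmono, fun s t => ?_, ?_, fun ε hε => ?_⟩
  · refine le_ciInf_add_ciInf fun m n => ?_
    have hm : (0 : ℝ) ≤ m := m.cast_nonneg
    have hn : (0 : ℝ) ≤ n := n.cast_nonneg
    rcases le_total m n with h | h
    · have h1 := hgf (s + t) n
      have h2 := hsub' s t m n h
      simp only [f] at h1 ⊢
      linarith
    · have h1 := hgf (s + t) m
      have h2 := hsub' t s n m h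
      rw [add_comm t s] at h2
      simp only [f] at h1 ⊢
      linarith
  · rw [tendsto_atTop]
    intro B
    obtain ⟨m, hm⟩ := exists_nat_ge B
    filter_upwards [eventually_ge_atTop (m * a m)] with t ht
    refine hm.trans (le_ciInf fun n => ?_)
    rcases le_total m n with h | h
    · have : (m : ℝ) ≤ n := by exact_mod_cast h
      have : 0 ≤ |t| / a n := div_nonneg (abs_nonneg _) (ha0 n).le
      simp only [f]
      linarith
    · have h1 : (m : ℝ) ≤ |t| / a n := by
        rw [le_div_iff₀ (ha0 n)]
        calc (m : ℝ) * a n ≤ m * a m := by gcongr; exact ha_mono h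
          _ ≤ t := ht
          _ ≤ |t| := le_abs_self t
      have : (0 : ℝ) ≤ n := n.cast_nonneg
      simp only [f]
      linarith
  · have hs : Tendsto (fun r : ℕ => √(r : ℝ)) atTop atTop :=
      Real.tendsto_sqrt_atTop.comp tendsto_natCast_atTop_atTop
    filter_upwards [hs.eventually_ge_atTop (4 / ε), hs.eventually_ge_atTop 1] with r h1 h2
    have h3 : g (φ r) ≤ Nat.sqrt r + 3 := by
      refine (hgf _ (Nat.sqrt r + 1)).trans ?_
      have : |φ r| / a (Nat.sqrt r + 1) ≤ 1 :=
        (div_le_one (ha0 _)).2 (haφ _ _ (Nat.lt_succ_sqrt' r).le)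
      simp only [f]
      push_cast
      linarith
    have h4 : (Nat.sqrt r : ℝ) ≤ √(r : ℝ) := Real.nat_sqrt_le_real_sqrt
    have h5 : 4 ≤ ε * √(r : ℝ) := by rwa [div_le_iff₀' hε] at h1
    calc g (φ r) ≤ 4 * √(r : ℝ) := by linarith
      _ ≤ ε * √(r : ℝ) * √(r : ℝ) := by gcongr
      _ = ε * r := by rw [mul_assoc, Real.mul_self_sqrt r.cast_nonneg]

/-- In a controlled compactification, balls of radius `η r` far from the base point `x₀` are small;
`φ r` says how far from `x₀` one has to go. -/
theorem IsControlledZCompactification.exists_escape_radius {X K : Type*} [MetricSpace X]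
    [MetricSpace K] {i : X → K} (hi : IsControlledZCompactification i) (η : ℝ≥0 → ℝ≥0) (x₀ : X) :
    ∃ φ : ℕ → ℝ, (∀ r : ℕ, η r ≤ φ r) ∧ ∀ (r : ℕ) (x y : X), φ r < dist x x₀ → dist y x ≤ η r →
      dist (i y) (i x) ≤ 2 / (r + 1) := by
  have key : ∀ r : ℕ, ∃ c : ℝ, η r ≤ c ∧ ∀ x y : X, c < dist x x₀ → dist y x ≤ η r →
      dist (i y) (i x) ≤ 2 / (r + 1) := by
    intro r
    have hη : (0 : ℝ) ≤ η r := (η r).2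
    -- The `+ 1` makes the diameter bound `2 * η r` strict.
    obtain ⟨C, hC, hC'⟩ := hi.controlled (2 * η r + 1) (by positivity)
      (range fun z : K => Metric.ball z (1 / ((r : ℝ) + 1)))
      ⟨by rintro _ ⟨z, rfl⟩; exact Metric.isOpen_ball, eq_univ_of_forall fun z =>
        ⟨_, ⟨z, rfl⟩, Metric.mem_ball_self (by positivity)⟩⟩
    obtain ⟨c, hc⟩ := hC.isBounded.subset_closedBall x₀
    -- Beyond `c + η r` the ball misses `C`; the second entry secures `η r ≤ φ r` even when `c` is
    -- negative.
    refine ⟨max (c + η r) (η r), le_max_right _ _, fun x y hx hy => ?_⟩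
    obtain ⟨_, ⟨z, rfl⟩, hz⟩ := hC' (Metric.closedBall x (η r)) (by
      intro w hw hwC
      have h1 := Metric.mem_closedBall.1 (hc hwC)
      have h2 := Metric.mem_closedBall'.1 hw
      have h3 := dist_triangle x w x₀
      have h4 := (le_max_left _ _).trans_lt hx
      linarith) (by
      have : Metric.ediam (Metric.closedBall x (η r : ℝ)) ≤ ENNReal.ofReal (2 * η r) := by
        refine Metric.ediam_le fun a ha b hb => ?_
        rw [edist_dist]
        refine ENNReal.ofReal_le_ofReal ?_
        have := dist_triangle_right a b x
        rw [Metric.mem_closedBall] at ha hb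
        linarith
      refine this.trans_lt ((ENNReal.ofReal_lt_ofReal_iff (by positivity)).2 (by linarith)))
    have h1 := hz ⟨y, hy, rfl⟩
    have h2 := hz ⟨x, Metric.mem_closedBall_self hη, rfl⟩
    rw [Metric.mem_ball] at h1 h2
    have := dist_triangle_right (i y) (i x) z
    have h3 : (2 : ℝ) / (r + 1) = 1 / (r + 1) + 1 / (r + 1) := by ring
    linarith
  choose φ hφ hφ' using key
  exact ⟨φ, hφ, hφ'⟩

/-! ### The embedding by slopes -/

namespace Suspension

/-- The map `X × ℝ → SK` sending `(x, r)` to the class of `(i x, r / p x)`. -/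
noncomputable def slopeMap {X K : Type*} (i : X → K) (p : X → ℝ) (a : X × ℝ) : Suspension K :=
  mk (i a.1) ((a.2 / p a.1 : ℝ) : EReal)

section slopeMap

variable {X K : Type*} {i : X → K} {p : X → ℝ}

/-- Division by `p x` is a bijection of each line `{x} × ℝ`, so the image does not depend on `p`. -/
theorem mem_range_slopeMap (hp : ∀ x, 0 < p x) {w : Suspension K} :
    w ∈ range (slopeMap i p) ↔ ∃ x, ∃ s : EReal, s ≠ ⊤ ∧ s ≠ ⊥ ∧ w = mk (i x) s := by
  constructor
  · rintro ⟨⟨x, r⟩, rfl⟩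
    exact ⟨x, _, EReal.coe_ne_top _, EReal.coe_ne_bot _, rfl⟩
  · rintro ⟨x, s, h₁, h₂, rfl⟩
    lift s to ℝ using ⟨h₁, h₂⟩
    refine ⟨(x, s * p x), ?_⟩
    simp [slopeMap, (hp x).ne']

theorem range_map_compl (hp : ∀ x, 0 < p x) :
    range (map (Subtype.val : ((range i)ᶜ : Set K) → K)) = (range (slopeMap i p))ᶜ := by
  ext w
  rw [mem_compl_iff, mem_range_slopeMap hp]
  constructor
  · rintro ⟨v, rfl⟩ ⟨x, s, h₁, h₂, he⟩
    have hs : height v = s := by rw [← height_map, he, height_mk]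
    obtain ⟨z, hz⟩ := exists_mk (hs ▸ h₁) (hs ▸ h₂)
    rw [hz, hs] at he
    have := congrArg base he
    change base (mk z.1 s) = _ at this
    rw [base_mk _ h₁ h₂, base_mk _ h₁ h₂, Option.some_inj] at this
    exact z.2 ⟨x, this.symm⟩
  · intro h
    by_cases ht : height w = ⊤
    · exact ⟨pole _ true, (eq_pole_true ht).symm⟩
    by_cases hb : height w = ⊥
    · exact ⟨pole _ false, (eq_pole_false hb).symm⟩
    obtain ⟨y, hy⟩ := exists_mk ht hb
    refine ⟨mk ⟨y, ?_⟩ (height w), hy.symm⟩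
    rintro ⟨x, rfl⟩
    exact h ⟨x, _, ht, hb, hy⟩

variable [TopologicalSpace K]

theorem denseRange_slopeMap [Nonempty K] (hi : DenseRange i) (hp : ∀ x, 0 < p x) :
    DenseRange (slopeMap i p) := by
  have hR : DenseRange ((↑) : ℝ → EReal) := EReal.denseRange_ratCast.mono (by
    rintro _ ⟨q, rfl⟩; exact ⟨_, rfl⟩)
  have h := mk_surjective.denseRange.comp (hi.prodMap hR) (continuous_mk (Y := K))
  refine h.mono ?_
  rintro _ ⟨⟨x, s⟩, rfl⟩
  exact (mem_range_slopeMap hp).2 ⟨x, _, EReal.coe_ne_top _, EReal.coe_ne_bot _, rfl⟩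

variable [TopologicalSpace X]

/-- The map is a fibrewise rescaling of `X × ℝ`, then an open embedding into `K × [-∞, ∞]` at finite
heights, where `mk` is injective and open. -/
theorem isOpenEmbedding_slopeMap (hi : IsOpenEmbedding i) (hp : ∀ x, 0 < p x) (hpc : Continuous p) :
    IsOpenEmbedding (slopeMap i p) := by
  have hq : Continuous fun a : X × ℝ => a.2 / p a.1 :=
    continuous_snd.div (by fun_prop) fun a => (hp a.1).ne'
  let e : X × ℝ ≃ₜ X × ℝ :=
    { toFun := fun a => (a.1, a.2 / p a.1)
      invFun := fun a => (a.1, a.2 * p a.1)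
      left_inv := fun a => by simp [(hp a.1).ne']
      right_inv := fun a => by simp [(hp a.1).ne']
      continuous_toFun := by fun_prop
      continuous_invFun := by fun_prop }
  have he : IsOpenEmbedding (Prod.map i ((↑) : ℝ → EReal) ∘ e) :=
    (hi.prodMap EReal.isOpenEmbedding_coe).comp e.isOpenEmbedding
  have hfin : ∀ a : X × ℝ, ((Prod.map i ((↑) : ℝ → EReal) ∘ e) a).2 ≠ ⊤ ∧
      ((Prod.map i ((↑) : ℝ → EReal) ∘ e) a).2 ≠ ⊥ := fun a =>
    ⟨EReal.coe_ne_top _, EReal.coe_ne_bot _⟩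
  refine .of_continuous_injective_isOpenMap (continuous_mk.comp he.continuous) ?_ fun V hV => ?_
  · intro a b hab
    have h₁ := congrArg height hab
    have h₂ := congrArg base hab
    refine he.injective (Prod.ext ?_ h₁)
    have h₃ := (base_mk (i a.1) (hfin a).1 (hfin a).2).symm.trans
      (h₂.trans (base_mk (i b.1) (hfin b).1 (hfin b).2))
    exact Option.some_injective _ h₃
  · have := isOpen_image_mk (he.isOpenMap V hV) (by rintro _ ⟨a, -, rfl⟩; exact hfin a)
    rwa [image_image] at this

end slopeMap

end Suspension

/-! ### The control condition -/

namespace Suspension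

/-- Consider points `x`, `y` with `y` in the ball of radius `η |k|` around `x`, and heights `θ` in
`[k, k + 1]`. If `(x, k)` escapes to infinity while `i x` and the slope `k / p x` converge, then
`(y, θ)` has the limit in the suspension that these determine. -/
theorem tendsto_slopeMap {X K : Type*} [MetricSpace X] [MetricSpace K] [CompactSpace K] {i : X → K}
    {η : ℝ≥0 → ℝ≥0} (hη : Monotone η) {x₀ : X} {φ : ℕ → ℝ} (hφ : ∀ r : ℕ, η r ≤ φ r)
    (hφi : ∀ (r : ℕ) (x y : X), φ r < dist x x₀ → dist y x ≤ η r → dist (i y) (i x) ≤ 2 / (r + 1))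
    {g : ℝ → ℝ} (hg1 : ∀ t, 1 ≤ g t) (hgm : ∀ s t, |s| ≤ |t| → g s ≤ g t)
    (hgs : ∀ s t, g (s + t) ≤ g s + g t) (hg : Tendsto g atTop atTop)
    (hgφ : ∀ ε > 0, ∀ᶠ r : ℕ in atTop, g (φ r) ≤ ε * r)
    {ι : Type*} {l : Filter ι} {k : ι → ℤ} {x y : ι → X} {θ : ι → ℝ}
    (hy : ∀ n, dist (y n) (x n) ≤ η (Real.nnabs (k n : ℝ)))
    (hθ : ∀ n, (k n : ℝ) ≤ θ n ∧ θ n ≤ k n + 1)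
    (hesc : ∀ N : ℝ, ∀ᶠ n in l, N < dist (x n) x₀ ∨ N < |(k n : ℝ)|)
    {z : K} {s : EReal} (hz : Tendsto (fun n => i (x n)) l (𝓝 z))
    (hs : Tendsto (fun n => (((k n : ℝ) / g (dist (x n) x₀) : ℝ) : EReal)) l (𝓝 s)) :
    Tendsto (fun n => slopeMap i (fun x => g (dist x x₀)) (y n, θ n)) l (𝓝 (mk z s)) := by
  set p : X → ℝ := fun x => g (dist x x₀) with hp
  have hp0 : ∀ x, 0 < p x := fun x => one_pos.trans_le (hg1 _)
  have hgm' : ∀ s t, 0 ≤ s → s ≤ t → g s ≤ g t := fun s t h h' =>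
    hgm s t (by rwa [abs_of_nonneg h, abs_of_nonneg (h.trans h')])
  have hple : ∀ a b, p a ≤ p b + g (dist a b) := fun a b =>
    (hgm' _ _ dist_nonneg ((dist_triangle a b x₀).trans_eq (add_comm _ _))).trans (hgs _ _)
  have hnn : ∀ n, Real.nnabs (k n : ℝ) = ((k n).natAbs : ℝ≥0) := fun n => by
    ext
    simp [Nat.cast_natAbs]
  have hgy : ∀ (n : ι) (r : ℕ), (k n).natAbs ≤ r → dist (y n) (x n) ≤ η r := fun n r hr =>
    (hy n).trans (by rw [hnn]; exact NNReal.coe_le_coe.2 (hη (by exact_mod_cast hr)))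
  have hgr : ∀ (n : ι) (r : ℕ), (k n).natAbs ≤ r → g (dist (y n) (x n)) ≤ g (φ r) := fun n r hr =>
    hgm' _ _ dist_nonneg ((hgy n r hr).trans (hφ r))
  have hcast : ∀ n, (((k n).natAbs : ℕ) : ℝ) = |(k n : ℝ)| := fun n => by simp [Nat.cast_natAbs]
  have hpole : Tendsto (fun n => |(k n : ℝ)| / p (x n)) l atTop →
      Tendsto (fun n => |(k n : ℝ)| / p (y n)) l atTop := by
    intro h
    have hk : Tendsto (fun n => (k n).natAbs) l atTop := by
      rw [← tendsto_natCast_atTop_iff (R := ℝ)]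
      refine tendsto_atTop_mono (fun n => ?_) h
      rw [hcast]
      exact div_le_self (abs_nonneg _) (hg1 _)
    rw [tendsto_atTop]
    intro B
    set M := max B 1 with hM
    have hM0 : 0 < M := one_pos.trans_le (le_max_right _ _)
    -- Slope at least `2 * M` gives `M * p x ≤ |k| / 2`, and the tolerance `1 / (2 * M)` bounds `M`
    -- times the growth of `p` by the other half.
    filter_upwards [h.eventually_ge_atTop (2 * M), hk.eventually (hgφ (1 / (2 * M)) (by positivity))]
      with n h1 h2
    refine (le_max_left B 1).trans ?_
    have h3 := (hple (y n) (x n)).trans (add_le_add_right ((hgr n _ le_rfl).trans h2) _)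
    rw [le_div_iff₀ (hp0 _)] at h1 ⊢
    rw [hcast] at h3
    calc M * p (y n) ≤ M * (p (x n) + 1 / (2 * M) * |(k n : ℝ)|) := by gcongr
      _ = (2 * M * p (x n)) / 2 + |(k n : ℝ)| / 2 := by field_simp
      _ ≤ _ := by linarith
  have habs : ∀ n, |(k n : ℝ) / p (x n)| = |(k n : ℝ)| / p (x n) := fun n => by
    rw [abs_div, abs_of_pos (hp0 _)]
  induction s with
  | top =>
    rw [mk_top]
    refine tendsto_mk_top (EReal.tendsto_coe_nhds_top_iff.2 ?_)
    have h1 : Tendsto (fun n => (k n : ℝ) / p (x n)) l atTop := EReal.tendsto_coe_nhds_top_iff.1 hs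
    have h2 := hpole ((tendsto_abs_atTop_atTop.comp h1).congr habs)
    refine tendsto_atTop_mono' l ?_ h2
    filter_upwards [h1.eventually_ge_atTop 0] with n hn
    have hk : (0 : ℝ) ≤ k n := by
      rwa [le_div_iff₀ (hp0 _), zero_mul] at hn
    have := hp0 (y n)
    rw [abs_of_nonneg hk]
    gcongr
    exact (hθ n).1
  | bot =>
    rw [mk_bot]
    refine tendsto_mk_bot (EReal.tendsto_coe_nhds_bot_iff.2 ?_)
    have h1 : Tendsto (fun n => (k n : ℝ) / p (x n)) l atBot := EReal.tendsto_coe_nhds_bot_iff.1 hs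
    have h2 := hpole ((tendsto_abs_atBot_atTop.comp h1).congr habs)
    refine tendsto_atBot_mono' l ?_ (tendsto_atBot_add_const_right l 1 (tendsto_neg_atTop_atBot.comp h2))
    filter_upwards [h1.eventually_le_atBot 0] with n hn
    have hk : (k n : ℝ) ≤ 0 := by
      rwa [div_le_iff₀ (hp0 _), zero_mul] at hn
    have h3 := hp0 (y n)
    -- Heights reach up to `k + 1`, which raises the slope by at most `1` since `p ≥ 1`.
    have h4 : 1 / p (y n) ≤ 1 := (div_le_one h3).2 (hg1 _)
    simp only [Function.comp_apply]
    rw [abs_of_nonpos hk, neg_div, neg_neg]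
    calc θ n / p (y n) ≤ (k n + 1) / p (y n) := by gcongr; exact (hθ n).2
      _ = k n / p (y n) + 1 / p (y n) := add_div _ _ _
      _ ≤ _ := by linarith
  | coe s =>
    have hs' : Tendsto (fun n => (k n : ℝ) / p (x n)) l (𝓝 s) := EReal.tendsto_coe.1 hs
    set M := |s| + 1 with hM
    have hM0 : 0 < M := by positivity
    have hkM : ∀ᶠ n in l, |(k n : ℝ)| ≤ M * p (x n) := by
      filter_upwards [hs'.abs.eventually (ge_mem_nhds (lt_add_one |s|))] with n hn
      rwa [habs, div_le_iff₀ (hp0 _)] at hn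
    -- Whichever coordinate escapes, `p x` grows: through `g` for the distance, through `|k| ≤ M * p
    -- x` for the height.
    have hpx : Tendsto (fun n => p (x n)) l atTop := by
      rw [tendsto_atTop]
      intro B
      obtain ⟨D, hD⟩ := (tendsto_atTop.1 hg B).exists_forall_of_atTop
      filter_upwards [hkM, hesc (max D (M * B))] with n h1 h2
      rcases h2 with h2 | h2
      · exact hD _ ((le_max_left _ _).trans h2.le)
      · have := ((le_max_right D (M * B)).trans_lt h2).trans_le h1
        exact (lt_of_mul_lt_mul_left this hM0.le).le
    -- An integer bound for `|k|` comparable to `p x`, so that `o(r)` means `o(p x)`.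
    let r : ι → ℕ := fun n => ⌈M * p (x n)⌉₊
    have hr : Tendsto r l atTop := tendsto_nat_ceil_atTop.comp (hpx.const_mul_atTop hM0)
    have hrle : ∀ᶠ n in l, (r n : ℝ) ≤ 2 * M * p (x n) := by
      filter_upwards [hpx.eventually_ge_atTop (1 / M)] with n hn
      have h1 := (Nat.ceil_lt_add_one (mul_pos hM0 (hp0 (x n))).le).le
      rw [div_le_iff₀' hM0] at hn
      simp only [r]
      linarith
    have hkr : ∀ᶠ n in l, (k n).natAbs ≤ r n := by
      filter_upwards [hkM] with n hn
      rw [← hcast] at hn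
      exact_mod_cast hn.trans (Nat.le_ceil _)
    have hsmall : ∀ ε > 0, ∀ᶠ n in l, g (φ (r n)) ≤ ε * p (x n) := by
      intro ε hε
      filter_upwards [hrle, hr.eventually (hgφ (ε / (2 * M)) (by positivity))] with n h1 h2
      calc _ ≤ ε / (2 * M) * r n := h2
        _ ≤ ε / (2 * M) * (2 * M * p (x n)) := by gcongr
        _ = _ := by field_simp
    -- Otherwise monotonicity of `g` would give `p x ≤ g (φ r) ≤ p x / 2`.
    have hfar : ∀ᶠ n in l, φ (r n) < dist (x n) x₀ := by
      filter_upwards [hsmall (1 / 2) (by norm_num)] with n h1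
      by_contra! h2
      have h3 : p (x n) ≤ g (φ (r n)) := hgm' _ _ dist_nonneg h2
      have := hp0 (x n)
      linarith
    have hiy : Tendsto (fun n => i (y n)) l (𝓝 z) := by
      refine (tendsto_iff_of_dist ?_).2 hz
      have h0 : Tendsto (fun n => (2 : ℝ) / ((r n : ℝ) + 1)) l (𝓝 0) :=
        Tendsto.div_atTop tendsto_const_nhds
          (tendsto_atTop_add_const_right _ _ (tendsto_natCast_atTop_atTop.comp hr))
      refine squeeze_zero' (.of_forall fun _ => dist_nonneg) ?_ h0
      filter_upwards [hfar, hkr] with n h1 h2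
      exact hφi _ _ _ h1 (hgy n _ h2)
    have hratio : Tendsto (fun n => p (y n) / p (x n)) l (𝓝 1) := by
      rw [Metric.tendsto_nhds]
      intro ε hε
      filter_upwards [hsmall (ε / 2) (by positivity), hkr] with n h1 h2
      have h3 := (hgr n _ h2).trans h1
      have h4 := hple (y n) (x n)
      have h5 := hple (x n) (y n)
      rw [dist_comm] at h5
      have h6 := hp0 (x n)
      have h7 : 0 < ε * p (x n) := mul_pos hε h6
      rw [Real.dist_eq, div_sub_one h6.ne', abs_div, abs_of_pos h6, div_lt_iff₀ h6, abs_lt]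
      constructor <;> linarith
    have hθx : Tendsto (fun n => θ n / p (x n)) l (𝓝 s) := by
      have h0 : Tendsto (fun n => (θ n - k n) / p (x n)) l (𝓝 0) := by
        refine squeeze_zero (fun n => div_nonneg (sub_nonneg.2 (hθ n).1) (hp0 _).le)
          (fun n => ?_) (tendsto_inv_atTop_zero.comp hpx)
        have := hp0 (x n)
        simp only [Function.comp_apply]
        rw [← one_div]
        gcongr
        linarith [(hθ n).2]
      have := hs'.add h0
      rw [add_zero] at this
      refine this.congr fun n => ?_
      rw [← add_div, add_sub_cancel]
    have hθy : Tendsto (fun n => θ n / p (y n)) l (𝓝 s) := by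
      have := hθx.div hratio one_ne_zero
      rw [div_one] at this
      refine this.congr fun n => ?_
      have := (hp0 (x n)).ne'
      simp only [Pi.div_apply]
      field_simp
    exact (continuous_mk.tendsto (z, (s : EReal))).comp
      (hiy.prodMk_nhds (EReal.tendsto_coe.2 hθy))

/-- The control condition for the map to the suspension given by a slow function. -/
theorem satisfiesControlCondition_slopeMap {X K : Type*} [MetricSpace X] [ProperSpace X]
    [MetricSpace K] [CompactSpace K] {i : X → K}
    {η : ℝ≥0 → ℝ≥0} (hη : Monotone η) {x₀ : X} {φ : ℕ → ℝ} (hφ : ∀ r : ℕ, η r ≤ φ r)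
    (hφi : ∀ (r : ℕ) (x y : X), φ r < dist x x₀ → dist y x ≤ η r → dist (i y) (i x) ≤ 2 / (r + 1))
    {g : ℝ → ℝ} (hg1 : ∀ t, 1 ≤ g t) (hgm : ∀ s t, |s| ≤ |t| → g s ≤ g t)
    (hgs : ∀ s t, g (s + t) ≤ g s + g t) (hg : Tendsto g atTop atTop)
    (hgφ : ∀ ε > 0, ∀ᶠ r : ℕ in atTop, g (φ r) ≤ ε * r) :
    SatisfiesControlCondition η (slopeMap i fun x => g (dist x x₀)) := by
  rintro 𝒰 ⟨h𝒰o, h𝒰⟩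
  by_contra! hcon
  have hcon' := fun n : ℕ =>
    hcon (Metric.closedBall x₀ n) n (isCompact_closedBall x₀ n) n.cast_nonneg
  choose k x hd hU using hcon'
  -- Along an ultrafilter the bad boxes have a limit base point and slope, hence tend to one point
  -- of the suspension; a cover member around it contradicts their badness.
  obtain ⟨𝒢, h𝒢⟩ := Ultrafilter.exists_le (atTop : Filter ℕ)
  let q : ℕ → K × EReal := fun n => (i (x n), (((k n : ℝ) / g (dist (x n) x₀) : ℝ) : EReal))
  obtain ⟨⟨z, s⟩, hzs⟩ : ∃ w, Tendsto q 𝒢 (𝓝 w) := ⟨_, (𝒢.map q).le_nhds_lim⟩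
  obtain ⟨U, hU𝒰, hzU⟩ : mk z s ∈ ⋃₀ 𝒰 := h𝒰 ▸ mem_univ _
  have hU' := fun n => not_subset.1 (hU n U hU𝒰)
  choose w hw hwU using hU'
  choose a ha haw using hw
  have hesc : ∀ N : ℝ, ∀ᶠ n in (𝒢 : Filter ℕ), N < dist (x n) x₀ ∨ N < |(k n : ℝ)| := by
    intro N
    filter_upwards [h𝒢 ((tendsto_natCast_atTop_atTop (R := ℝ)).eventually_ge_atTop N)] with n hn
    by_contra! hc
    have hn' : N ≤ n := hn
    have hmem := Set.disjoint_left.1 (hd n)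
    refine @hmem (x n, (k n : ℝ)) ⟨Metric.mem_closedBall_self (NNReal.coe_nonneg _), le_rfl, by simp⟩
      ⟨hc.1.trans hn', abs_le.1 (hc.2.trans hn')⟩
  have hlim := tendsto_slopeMap hη hφ hφi hg1 hgm hgs hg hgφ (fun n => (ha n).1)
    (fun n => (ha n).2) hesc ((continuous_fst.tendsto _).comp hzs)
    ((continuous_snd.tendsto _).comp hzs)
  obtain ⟨n, hn⟩ := (hlim.eventually ((h𝒰o U hU𝒰).mem_nhds hzU)).exists
  exact hwU n (haw n ▸ hn)

end Suspension

/-! ### Transport along homeomorphisms -/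

section Homeomorph

variable {Y K K' : Type*} [TopologicalSpace K] [TopologicalSpace K'] {j : Y → K}

theorem compl_range_homeomorph_comp (e : K ≃ₜ K') : (range (e ∘ j))ᶜ = e '' (range j)ᶜ := by
  rw [image_compl_eq e.bijective, range_comp]

theorem IsZSet.image_homeomorph {Z : Set K} (h : IsZSet Z) (e : K ≃ₜ K') : IsZSet (e '' Z) := by
  obtain ⟨hZ, α, hα, hα₀, hα₁⟩ := h
  refine ⟨e.isClosed_image.2 hZ, fun a => e (α (e.symm a.1, a.2)),
    e.continuous.comp (hα.comp (by fun_prop)), fun y => by simp [hα₀], fun y t ht => ?_⟩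
  rintro ⟨z, hz, he⟩
  exact hα₁ _ t ht (e.injective he ▸ hz)

theorem IsZCompactification.homeomorph_comp [TopologicalSpace Y] (h : IsZCompactification j)
    (e : K ≃ₜ K') : IsZCompactification (e ∘ j) where
  compactSpace := have := h.compactSpace; e.compactSpace
  t2Space := have := h.t2Space; e.t2Space
  isEmbedding := e.isEmbedding.comp h.isEmbedding
  denseRange := e.surjective.denseRange.comp h.denseRange e.continuous
  isZSet := compl_range_homeomorph_comp e ▸ h.isZSet.image_homeomorph e

theorem SatisfiesControlCondition.homeomorph_comp {X : Type*} [MetricSpace X] {η : ℝ≥0 → ℝ≥0}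
    {j : X × ℝ → K} (h : SatisfiesControlCondition η j) (e : K ≃ₜ K') :
    SatisfiesControlCondition η (e ∘ j) := by
  rintro 𝒰 ⟨h𝒰o, h𝒰⟩
  obtain ⟨Q, N, hQ, hN, H⟩ := h ((fun U => e ⁻¹' U) '' 𝒰)
    ⟨by rintro _ ⟨U, hU, rfl⟩; exact (h𝒰o U hU).preimage e.continuous, by
      rw [sUnion_image, ← preimage_iUnion₂, ← sUnion_eq_biUnion, h𝒰, preimage_univ]⟩
  refine ⟨Q, N, hQ, hN, fun k x hd => ?_⟩
  obtain ⟨_, ⟨U, hU, rfl⟩, hsub⟩ := H k x hd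
  refine ⟨U, hU, ?_⟩
  rw [image_comp]
  exact image_subset_iff.2 hsub

end Homeomorph

/-! ### Assembly of the compactification -/

/-- The suspension of a `Z`-compactification of a contractible space, with `X × ℝ` embedded by
slopes, is a `Z`-compactification. -/
theorem IsZCompactification.slopeMap {X K : Type*} [TopologicalSpace X] [ContractibleSpace X]
    [TopologicalSpace K] {i : X → K} (hi : IsZCompactification i) {p : X → ℝ}
    (hp : ∀ x, 0 < p x) (hpc : Continuous p) : IsZCompactification (Suspension.slopeMap i p) := by
  have := hi.compactSpace
  have := hi.t2Space
  obtain ⟨x₀, h, h₀, h₁, hS⟩ := hi.isZSet.exists_contraction hi.isEmbedding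
  have : Nonempty K := ⟨i x₀⟩
  have hio : IsOpenEmbedding i := ⟨hi.isEmbedding, isClosed_compl_iff.1 hi.isZSet.1⟩
  have hj := Suspension.isOpenEmbedding_slopeMap hio hp hpc
  obtain ⟨A, hA, hA₀, hA₁⟩ := Suspension.exists_homotopy (i x₀) h h₀ h₁ hS
  exact
    { compactSpace := inferInstance
      t2Space := inferInstance
      isEmbedding := hj.isEmbedding
      denseRange := Suspension.denseRange_slopeMap hi.denseRange hp
      isZSet := ⟨hj.isOpen_range.isClosed_compl, A, hA, hA₀, fun w t ht => by
        obtain ⟨_, ⟨x, rfl⟩, s, hs, hs', he⟩ := hA₁ w t ht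
        exact not_not.2 ((Suspension.mem_range_slopeMap hp).2 ⟨x, s, hs, hs', he⟩)⟩ }

/-- The remainder of `X × ℝ` in the suspension is the suspension of the remainder of `X`. -/
theorem IsZCompactification.nonempty_homeomorph_slopeMap {X K : Type*} [TopologicalSpace X]
    [TopologicalSpace K] {i : X → K} (hi : IsZCompactification i) {p : X → ℝ} (hp : ∀ x, 0 < p x) :
    Nonempty (Suspension ((range i)ᶜ : Set K) ≃ₜ
      ((range (Suspension.slopeMap i p))ᶜ : Set (Suspension K))) := by
  have := hi.compactSpace
  have := hi.t2Space
  have : CompactSpace ((range i)ᶜ : Set K) := isCompact_iff_compactSpace.1 hi.isZSet.1.isCompact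
  have he := ((Suspension.continuous_map continuous_subtype_val).isClosedEmbedding
    (Suspension.map_injective Subtype.val_injective)).isEmbedding.toHomeomorph (Y := Suspension K)
    (X := Suspension ((range i)ᶜ : Set K))
  exact ⟨he.trans (Homeomorph.setCongr (Suspension.range_map_compl hp))⟩

theorem mainTheorem12 {X : Type u} [MetricSpace X] [ProperSpace X] [ContractibleSpace X]
    {Xbar : Type v} [TopologicalSpace Xbar] (i : X → Xbar)
    (hi : IsControlledZCompactification i)
    (η : ℝ≥0 → ℝ≥0) (hη : Monotone η) (hη_lim : Tendsto η atTop atTop) :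
    ∃ (W : Type (max u v)) (_ : TopologicalSpace W) (j : X × ℝ → W),
      IsZCompactification j ∧
      Nonempty (Suspension ((range i)ᶜ : Set Xbar) ≃ₜ ((range j)ᶜ : Set W)) ∧
      SatisfiesControlCondition η j := by
  have := hi.compactSpace
  have := hi.t2Space
  have : TopologicalSpace.MetrizableSpace Xbar := hi.isZSet.metrizableSpace hi.isEmbedding
  let _ : MetricSpace Xbar := TopologicalSpace.metrizableSpaceMetric Xbar
  obtain ⟨x₀⟩ : Nonempty X := inferInstance
  obtain ⟨φ, hφ, hφi⟩ := hi.exists_escape_radius η x₀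
  obtain ⟨g, hgc, hg1, hgm, hgs, hg, hgφ⟩ := exists_slow_subadditive φ
  have hp : ∀ x, 0 < g (dist x x₀) := fun x => one_pos.trans_le (hg1 _)
  have hpc : Continuous fun x => g (dist x x₀) := by fun_prop
  -- Moves the suspension from `Type v` to the universe `max u v`.
  let e : Suspension Xbar ≃ₜ ULift.{u} (Suspension Xbar) := Homeomorph.ulift.symm
  obtain ⟨f⟩ := hi.toIsZCompactification.nonempty_homeomorph_slopeMap hp
  refine ⟨ULift.{u} (Suspension Xbar), inferInstance, e ∘ Suspension.slopeMap i _,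
    (hi.toIsZCompactification.slopeMap hp hpc).homeomorph_comp e,
    ⟨f.trans ((e.image _).trans (Homeomorph.setCongr (compl_range_homeomorph_comp e).symm))⟩,
    (Suspension.satisfiesControlCondition_slopeMap hη hφ hφi hg1 hgm hgs hg hgφ).homeomorph_comp e⟩
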